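/- Let $\mathcal I$ be a finite non-empty set of $n$ agents, let $\mathcal A_i$ be the finite non-empty action set of agent $i$, $\mathcal A=\prod_i\mathcal A_i$, and let $U_i:\mathcal A\to\mathbb R$ be utilities that form a potential game with potential $\phi:\mathcal A\to\mathbb R$, i.e. $U_i(a_i',a_{-i})-U_i(a_i,a_{-i})=\phi(a_i',a_{-i})-\phi(a_i,a_{-i})$ for all $i$, $a_i,a_i'$, $a_{-i}$. Let $\mathcal A_i^{\mathrm{cons}}(a_i)\subseteq\mathcal A_i$ be non-empty constrained action sets that are reachable (for all $i$ and $x,y\in\mathcal A_i$ there is a finite sequence $x=a_i^0,a_i^1,\dots,a_i^k=y$ with $a_i^{l}\in\mathcal A_i^{\mathrm{cons}}(a_i^{l-1})$) and reversible ($y\in\mathcal A_i^{\mathrm{cons}}(x)$ implies $x\in\mathcal A_i^{\mathrm{cons}}(y)$). For every set $C$ of agents let $U_i(a\mid C)\in\mathbb R$ be the utility of $i$ as evaluated when $i$ communicates exactly with the agents in $C$; it is arbitrary except that $U_i(a\mid\mathcal I)=U_i(a)$. Let $m_{i,j}(a)>0$ ($i\ne j$, $a\in\mathcal A$) be constants such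 that $$\sum_{j\notin C}m_{i,j}(a^0)\ \ge\ \big[\max\{U_i(a^0),U_i(a^1)\}-U_i(a^1)\big]-\big[\max\{U_i(a^0\mid C),U_i(a^1\mid C)\}-U_i(a^1\mid C)\big]$$ for every agent $i$, every $C\ni i$, and all $a^0,a^1$ with $a^1=(a_i^1,a^0_{-i})$ and $a_i^1\in\mathcal A_i^{\mathrm{cons}}(a_i^0)$. For $\tau>0$ put $\epsilon=e^{-1/\tau}$, $p_{\mathrm c,i,i}(a)=1$ and $p_{\mathrm c,i,j}(a)=\frac1{1+\epsilon^{m_{i,j}(a)}}$ for $j\neq i$, and consider the following Markov chain on $\mathcal A$ (binary log-linear learning with stochastic communication links). From the profile $a$, choose an agent $i$ uniformly from $\mathcal I$ and a trial action $\hat a_i$ uniformly from $\mathcal A_i^{\mathrm{cons}}(a_i)$; draw the set $C$ of agents that $i$ communicates with, with probability $\prod_{j\notin C}(1-p_{\mathrm c,i,j}(a))\prod_{j\in C}p_{\mathrm c,i,j}(a)$; all other agents repeat their actions, and agent $i$ plays $\hat a_i$ with probability $$\frac{e^{U_i(\hat a_i,a_{-i}\mid C)/\tau}}{e^{U_i(a\mid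 C)/\tau}+e^{U_i(\hat a_i,a_{-i}\mid C)/\tau}}$$ and otherwise repeats $a_i$. Then for every $p_{\mathrm{tar}}<1$ there is a $\tau_{\mathrm{th}}>0$ such that, for all $0<\tau\le\tau_{\mathrm{th}}$, this chain has a unique stationary distribution $\mu$, and $\mu(\{a\in\mathcal A:\phi(a)\ge\phi(b)\ \forall b\in\mathcal A\})\ge p_{\mathrm{tar}}$. -/

import Mathlib

noncomputable section

namespace BLLL

variable {ι : Type*} {A : ι → Type*}

/-- `U` (the utilities `U i a` of the agents `i` at the action profiles `a`) is a potential game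
with potential function `φ`. -/
def IsPotentialGame [DecidableEq ι] (U : ι → (∀ i, A i) → ℝ) (φ : (∀ i, A i) → ℝ) : Prop :=
  ∀ (i : ι) (a : ∀ i, A i) (x y : A i),
    U i (Function.update a i y) - U i (Function.update a i x) =
      φ (Function.update a i y) - φ (Function.update a i x)

/-- Reachability of constrained action sets: every action of an agent can be reached from every
other one by finitely many steps `x → y` with `y ∈ cons i x`. -/
def Reachable (cons : ∀ i, A i → Finset (A i)) : Prop :=
  ∀ (i : ι) (x y : A i), Relation.ReflTransGen (fun u v => v ∈ cons i u) x y

/-- Reversibility of constrained action sets. -/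
def Reversible (cons : ∀ i, A i → Finset (A i)) : Prop :=
  ∀ (i : ι) (x y : A i), y ∈ cons i x → x ∈ cons i y

/-- The parameter `ε = e^{-1/τ}` of the temperature `τ`. -/
def eps (τ : ℝ) : ℝ := Real.exp (-1 / τ)

/-- Probability of connectivity of the link between `i` and `j` at the profile `a`: an agent always
hears itself, and for `j ≠ i` it is `1 / (1 + ε ^ m i j a)`. -/
def linkProb [DecidableEq ι] (m : ι → ι → (∀ i, A i) → ℝ) (τ : ℝ) (i j : ι) (a : ∀ i, A i) : ℝ :=
  if i = j then 1 else 1 / (1 + eps τ ^ m i j a)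

/-- Probability that, at the profile `a`, the set of agents that agent `i` communicates with is
exactly `C`; the links are independent. -/
def commSetProb [Fintype ι] [DecidableEq ι] (m : ι → ι → (∀ i, A i) → ℝ) (τ : ℝ) (i : ι)
    (C : Finset ι) (a : ∀ i, A i) : ℝ :=
  (∏ j ∈ Cᶜ, (1 - linkProb m τ i j a)) * ∏ j ∈ C, linkProb m τ i j a

/-- Binary logit choice: the probability of playing an option of (evaluated) utility `u` when the
alternative has (evaluated) utility `v`. -/
def logit (τ u v : ℝ) : ℝ := Real.exp (u / τ) / (Real.exp (u / τ) + Real.exp (v / τ))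

/-- Transition matrix, at temperature `τ`, of binary log-linear learning over the constrained action
sets `cons` with stochastic communication links. `Uc i C a` is the utility of agent `i` at the
profile `a` as evaluated when `i` communicates exactly with the agents in `C`. From the profile
`a`, an agent `i` is drawn uniformly, a trial action `x` is drawn uniformly from `cons i (a i)`, the
set `C` is drawn with probability `commSetProb m τ i C a`, and `i` then either switches to `x` or
repeats `a i`, by a binary logit choice on its evaluated utilities. -/
def transition [Fintype ι] [DecidableEq ι] [∀ i, DecidableEq (A i)]
    (cons : ∀ i, A i → Finset (A i)) (Uc : ι → Finset ι → (∀ i, A i) → ℝ)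
    (m : ι → ι → (∀ i, A i) → ℝ) (τ : ℝ) : Matrix (∀ i, A i) (∀ i, A i) ℝ :=
  Matrix.of fun a b =>
    ∑ i : ι, 1 / (Fintype.card ι : ℝ) *
      ∑ x ∈ cons i (a i), 1 / ((cons i (a i)).card : ℝ) *
        ∑ C : Finset ι, commSetProb m τ i C a *
          ((if b = Function.update a i x then
              logit τ (Uc i C (Function.update a i x)) (Uc i C a) else 0) +
            (if b = a then logit τ (Uc i C a) (Uc i C (Function.update a i x)) else 0))

/-- `μ` is a stationary probability distribution of the transition matrix `P`. -/
def IsStationary {X : Type*} [Fintype X] (P : Matrix X X ℝ) (μ : X → ℝ) : Prop :=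
  μ ∈ stdSimplex ℝ X ∧ Matrix.vecMul μ P = μ

/-- The resistance `max {u₀, u₁} - u₁` of a move from a profile of utility `u₀` to a profile of
utility `u₁`. -/
def resistance (u₀ u₁ : ℝ) : ℝ := max u₀ u₁ - u₁

/-- The condition on the constants `m`: for every agent `i`, every set `C ∋ i` of agents that `i`
may communicate with, and every feasible transition `a → (x, a_{-i})`, the sum of `m i j a` over
`j ∉ C` is at least the resistance under perfect communication minus the resistance given `C`. -/
def SufficientLinks [Fintype ι] [DecidableEq ι]
    (cons : ∀ i, A i → Finset (A i)) (U : ι → (∀ i, A i) → ℝ)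
    (Uc : ι → Finset ι → (∀ i, A i) → ℝ) (m : ι → ι → (∀ i, A i) → ℝ) : Prop :=
  ∀ (i : ι) (C : Finset ι), i ∈ C → ∀ (a : ∀ i, A i), ∀ x ∈ cons i (a i),
    resistance (U i a) (U i (Function.update a i x)) -
        resistance (Uc i C a) (Uc i C (Function.update a i x)) ≤
      ∑ j ∈ Cᶜ, m i j a

open Classical in
/-- The set of global maximizers of the potential function. -/
def potentialMaximizers [Fintype ι] [DecidableEq ι] [∀ i, Fintype (A i)]
    (φ : (∀ i, A i) → ℝ) : Finset (∀ i, A i) :=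
  Finset.univ.filter fun a => ∀ b, φ b ≤ φ a

end BLLL

end

/-!
Let `w a = exp (φ a / τ)`. For a feasible move `a → b` of agent `i`, the transition probability has
the exact exponential order `exp (-R / τ)` with `R = max (U i a) (U i b) - U i b`: the event that
all links work contributes this order (`le_switchProb`), and by the condition on `m` no other
communication set contributes more (`switchProb_le`). The resistances of a move and of its reversal
differ by `φ a - φ b`, so the chain satisfies detailed balance with respect to `w` up to a factor
`K` that does not depend on `τ` (`nearlyReversible_transition`).

A stationary distribution `μ` of such a chain satisfies `μ a / w a ≤ K ^ N * (μ b / w b)` for all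
`a` and `b`, where `N` is the number of profiles (`density_le`). Indeed, the stationary flows into
and out of any set balance; if `μ / w ≥ L` on a set `S`, then the flow out of `S` is large enough to
force `μ / w ≥ L / K` at some point outside `S`. Adding such points one at a time exhausts the
space. This replaces the usual argument with minimal-resistance trees.

Taking for `b` a maximizer of `φ`, the mass of each non-maximizer `a` is at most
`K ^ N * exp (-(φ b - φ a) / τ)`, which tends to `0` with `τ`. The same inequality makes every
non-negative invariant vector with a zero vanish, whence uniqueness (`IsStationary.unique`).
-/

open Finset

namespace BLLL

/-! ### Invariant vectors of nearly reversible chains -/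

section Chain

variable {X : Type*} [Fintype X]

/-- Every cut is crossed by a transition of positive probability. This is irreducibility, in the
form in which flow arguments use it. -/
def CrossesCuts (P : Matrix X X ℝ) : Prop :=
  ∀ S : Finset X, S.Nonempty → S ≠ univ → ∃ a ∈ S, ∃ b ∉ S, 0 < P a b

/-- `P` satisfies detailed balance with respect to `w` up to the factor `K`. -/
def NearlyReversible (P : Matrix X X ℝ) (w : X → ℝ) (K : ℝ) : Prop :=
  ∀ a b, a ≠ b → w a * P a b ≤ K * (w b * P b a)

/-- The stationary flow out of a set equals the flow into it. -/
lemma flow_balance [DecidableEq X] {P : Matrix X X ℝ} (hrow : ∀ a, ∑ b, P a b = 1) {v : X → ℝ}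
    (hv : Matrix.vecMul v P = v) (S : Finset X) :
    ∑ a ∈ S, ∑ b ∈ Sᶜ, v a * P a b = ∑ a ∈ S, ∑ b ∈ Sᶜ, v b * P b a := by
  have h1 : ∑ a ∈ S, v a = ∑ a ∈ S, ∑ b ∈ S, v a * P a b + ∑ a ∈ S, ∑ b ∈ Sᶜ, v a * P a b := by
    rw [← sum_add_distrib]
    refine sum_congr rfl fun a _ => ?_
    rw [sum_add_sum_compl, ← mul_sum, hrow, mul_one]
  have h2 : ∑ a ∈ S, v a = ∑ a ∈ S, ∑ b ∈ S, v b * P b a + ∑ a ∈ S, ∑ b ∈ Sᶜ, v b * P b a := by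
    rw [← sum_add_distrib]
    refine sum_congr rfl fun a _ => ?_
    rw [sum_add_sum_compl]
    exact (congrFun hv a).symm
  rw [sum_comm (s := S) (t := S) (f := fun a b => v b * P b a)] at h2
  linarith

/-- If `v ≥ (L / J) w` on a proper non-empty set `S`, then some point outside `S` satisfies the same
bound with a loss of a factor `K` only; otherwise more would flow out of `S` than into it. -/
lemma exists_notMem_le_of_forall_mem_le [DecidableEq X] {P : Matrix X X ℝ} {w : X → ℝ} {K : ℝ}
    (hP : ∀ a b, 0 ≤ P a b)
    (hrow : ∀ a, ∑ b, P a b = 1) (hcut : CrossesCuts P) (hK : 0 < K) (hw : ∀ a, 0 < w a)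
    (hrev : NearlyReversible P w K) {v : X → ℝ}
    (hv : Matrix.vecMul v P = v) {S : Finset X} (hS : S.Nonempty) (hS' : S ≠ univ) {L J : ℝ}
    (hL : 0 ≤ L) (h : ∀ a ∈ S, L * w a ≤ J * v a) :
    ∃ b ∉ S, L * w b ≤ K * J * v b := by
  by_contra! hcon
  obtain ⟨a₀, ha₀, b₀, hb₀, hpos⟩ := hcut S hS hS'
  have hne : ∀ {a b}, a ∈ S → b ∉ S → a ≠ b := fun ha hb e => hb (e ▸ ha)
  have hpos' : 0 < P b₀ a₀ := by
    have h1 := hrev a₀ b₀ (hne ha₀ hb₀)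
    have h2 : 0 < w a₀ * P a₀ b₀ := mul_pos (hw _) hpos
    exact pos_of_mul_pos_right (pos_of_mul_pos_right (h2.trans_le h1) hK.le) (hw _).le
  have hle : ∀ a ∈ S, ∀ b ∈ Sᶜ, K * J * (v b * P b a) ≤ L * (w b * P b a) := fun a _ b hb => by
    have := mul_le_mul_of_nonneg_right (hcon b (mem_compl.1 hb)).le (hP b a)
    linarith
  have h1 : K * J * ∑ a ∈ S, ∑ b ∈ Sᶜ, v b * P b a < ∑ a ∈ S, ∑ b ∈ Sᶜ, L * (w b * P b a) := by
    simp only [mul_sum]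
    refine sum_lt_sum (fun a ha => sum_le_sum (hle a ha)) ⟨a₀, ha₀, ?_⟩
    refine sum_lt_sum (hle a₀ ha₀) ⟨b₀, mem_compl.2 hb₀, ?_⟩
    have := mul_lt_mul_of_pos_right (hcon b₀ hb₀) hpos'
    linarith
  have h2 : ∑ a ∈ S, ∑ b ∈ Sᶜ, L * (w b * P b a) ≤ K * J * ∑ a ∈ S, ∑ b ∈ Sᶜ, v a * P a b := by
    simp only [mul_sum]
    refine sum_le_sum fun a ha => sum_le_sum fun b hb => ?_
    have e1 := mul_le_mul_of_nonneg_left (hrev b a (hne ha (mem_compl.1 hb)).symm) hL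
    have e2 := mul_le_mul_of_nonneg_left
      (mul_le_mul_of_nonneg_right (h a ha) (hP a b)) hK.le
    linarith
  rw [flow_balance hrow hv] at h2
  linarith

/-- Harnack inequality: the density `v / w` of a non-negative invariant vector varies at most by the
factor `K ^ |X|`. -/
lemma density_le {P : Matrix X X ℝ} {w : X → ℝ} {K : ℝ} (hP : ∀ a b, 0 ≤ P a b)
    (hrow : ∀ a, ∑ b, P a b = 1) (hcut : CrossesCuts P) (hK : 1 ≤ K) (hw : ∀ a, 0 < w a)
    (hrev : NearlyReversible P w K) {v : X → ℝ} (hv0 : ∀ a, 0 ≤ v a)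
    (hv : Matrix.vecMul v P = v) (a b : X) :
    v a / w a * w b ≤ K ^ Fintype.card X * v b := by
  classical
  have key : ∀ k : ℕ, ∃ S : Finset X, S.Nonempty ∧ min (k + 1) (Fintype.card X) ≤ S.card ∧
      ∀ c ∈ S, v a / w a * w c ≤ K ^ k * v c := by
    intro k
    induction k with
    | zero =>
      refine ⟨{a}, singleton_nonempty a, by simp, fun c hc => ?_⟩
      rw [mem_singleton.1 hc, div_mul_cancel₀ _ (hw a).ne', pow_zero, one_mul]
    | succ k ih =>
      obtain ⟨S, hS, hcard, hle⟩ := ih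
      have hle' : ∀ c ∈ S, v a / w a * w c ≤ K ^ (k + 1) * v c := fun c hc =>
        (hle c hc).trans
          (mul_le_mul_of_nonneg_right (pow_le_pow_right₀ hK k.le_succ) (hv0 c))
      by_cases hS' : S = univ
      · exact ⟨S, hS, by rw [hS', card_univ]; exact min_le_right _ _, hle'⟩
      · obtain ⟨b, hb, hLb⟩ := exists_notMem_le_of_forall_mem_le hP hrow hcut
          (one_pos.trans_le hK) hw hrev hv hS hS' (div_nonneg (hv0 a) (hw a).le) hle
        refine ⟨insert b S, insert_nonempty _ _, ?_, fun c hc => ?_⟩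
        · rw [card_insert_of_notMem hb]
          omega
        · rcases mem_insert.1 hc with rfl | hc
          · rwa [pow_succ']
          · exact hle' c hc
  obtain ⟨S, -, hcard, hle⟩ := key (Fintype.card X)
  refine hle b ?_
  have : S = univ := (card_eq_iff_eq_univ S).1
    (le_antisymm (card_le_univ S) (by simpa using hcard))
  exact this ▸ mem_univ b

/-- A non-negative invariant vector with a zero vanishes identically. -/
lemma eq_zero_of_apply_eq_zero {P : Matrix X X ℝ} {w : X → ℝ} {K : ℝ} (hP : ∀ a b, 0 ≤ P a b)
    (hrow : ∀ a, ∑ b, P a b = 1) (hcut : CrossesCuts P) (hK : 1 ≤ K) (hw : ∀ a, 0 < w a)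
    (hrev : NearlyReversible P w K) {v : X → ℝ} (hv0 : ∀ a, 0 ≤ v a)
    (hv : Matrix.vecMul v P = v) {b : X} (hb : v b = 0) : v = 0 := by
  funext a
  have h := density_le hP hrow hcut hK hw hrev hv0 hv a b
  rw [hb, mul_zero] at h
  have h2 : v a / w a ≤ 0 := nonpos_of_mul_nonpos_left h (hw b)
  rw [div_le_iff₀ (hw a), zero_mul] at h2
  exact le_antisymm h2 (hv0 a)

/-- A stochastic matrix has a stationary distribution: `1` is an eigenvalue of the transpose, and
the absolute values of the entries of an invariant vector form an invariant vector again. -/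
lemma exists_isStationary [Nonempty X] {P : Matrix X X ℝ} (hP : ∀ a b, 0 ≤ P a b)
    (hrow : ∀ a, ∑ b, P a b = 1) : ∃ μ, IsStationary P μ := by
  classical
  obtain ⟨v, hv0, hv⟩ : ∃ v : X → ℝ, v ≠ 0 ∧ Matrix.vecMul v (P - 1) = 0 := by
    rw [Matrix.exists_vecMul_eq_zero_iff, ← Matrix.exists_mulVec_eq_zero_iff]
    refine ⟨fun _ => 1, fun h => one_ne_zero (congrFun h (Classical.arbitrary X)), ?_⟩
    funext a
    rw [Matrix.sub_mulVec, Matrix.one_mulVec]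
    simp [Matrix.mulVec, dotProduct, hrow]
  rw [Matrix.vecMul_sub, Matrix.vecMul_one, sub_eq_zero] at hv
  have hvb : ∀ b, ∑ a, v a * P a b = v b := fun b => congrFun hv b
  have hle : ∀ b, |v b| ≤ ∑ a, |v a| * P a b := fun b => by
    rw [← hvb b]
    refine (abs_sum_le_sum_abs _ _).trans_eq (sum_congr rfl fun a _ => ?_)
    rw [abs_mul, abs_of_nonneg (hP a b)]
  -- Both sides of `hle` have the same sum over `b`, hence they agree.
  have hsum : ∑ b, |v b| = ∑ b, ∑ a, |v a| * P a b := by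
    rw [sum_comm]
    simp only [← mul_sum, hrow, mul_one]
  have heq := (sum_eq_sum_iff_of_le fun b _ => hle b).1 hsum
  have hpos : 0 < ∑ b, |v b| := by
    obtain ⟨c, hc⟩ := Function.ne_iff.1 hv0
    exact sum_pos' (fun _ _ => abs_nonneg _) ⟨c, mem_univ c, abs_pos.2 hc⟩
  refine ⟨fun a => |v a| / ∑ b, |v b|, ⟨fun a => div_nonneg (abs_nonneg _) hpos.le, ?_⟩, ?_⟩
  · rw [← sum_div, div_self hpos.ne']
  · funext b
    change ∑ a, |v a| / (∑ b, |v b|) * P a b = _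
    rw [heq b (mem_univ b), sum_div]
    exact sum_congr rfl fun a _ => div_mul_eq_mul_div _ _ _

/-- Two stationary distributions agree: subtracting from one the largest multiple of the other that
keeps it non-negative leaves an invariant vector with a zero. -/
lemma IsStationary.unique [Nonempty X] {P : Matrix X X ℝ} {w : X → ℝ} {K : ℝ}
    (hP : ∀ a b, 0 ≤ P a b)
    (hrow : ∀ a, ∑ b, P a b = 1) (hcut : CrossesCuts P) (hK : 1 ≤ K) (hw : ∀ a, 0 < w a)
    (hrev : NearlyReversible P w K) {μ ν : X → ℝ} (hμ : IsStationary P μ)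
    (hν : IsStationary P ν) : ν = μ := by
  have hpos : ∀ a, 0 < μ a := fun a => (hμ.1.1 a).lt_of_ne' fun h => by
    have := hμ.1.2
    rw [eq_zero_of_apply_eq_zero hP hrow hcut hK hw hrev hμ.1.1 hμ.2 h] at this
    simp at this
  obtain ⟨c, hc⟩ := Finite.exists_min fun a => ν a / μ a
  have hzero : ν - (ν c / μ c) • μ = 0 := by
    refine eq_zero_of_apply_eq_zero hP hrow hcut hK hw hrev (b := c) (fun a => ?_) ?_ ?_
    · have := (le_div_iff₀ (hpos a)).1 (hc a)
      simpa using this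
    · rw [Matrix.sub_vecMul, Matrix.smul_vecMul, hμ.2, hν.2]
    · simp [div_mul_cancel₀ _ (hpos c).ne']
  have hν' : ν = (ν c / μ c) • μ := sub_eq_zero.1 hzero
  have h1 : ν c / μ c = 1 := by
    have := hν.1.2
    rw [hν'] at this
    simpa only [Pi.smul_apply, smul_eq_mul, ← mul_sum, hμ.1.2, mul_one] using this
  rw [hν', h1, one_smul]

end Chain

/-! ### Estimates for the links and for the logit choice -/

lemma eps_rpow (τ r : ℝ) : eps τ ^ r = Real.exp (-r / τ) := by
  rw [eps, ← Real.exp_mul]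
  congr 1
  ring

lemma logit_nonneg (τ u v : ℝ) : 0 ≤ logit τ u v := by
  unfold logit
  positivity

lemma logit_add_logit (τ u v : ℝ) : logit τ u v + logit τ v u = 1 := by
  unfold logit
  rw [add_comm (Real.exp (v / τ)), ← add_div, div_self (by positivity)]

lemma exp_max_div {τ : ℝ} (hτ : 0 < τ) (u v : ℝ) :
    Real.exp (max u v / τ) = max (Real.exp (u / τ)) (Real.exp (v / τ)) := by
  rw [← Real.exp_monotone.map_max, max_div_div_right hτ.le]

lemma exp_neg_resistance {τ : ℝ} (hτ : 0 < τ) (u v : ℝ) :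
    Real.exp (-resistance v u / τ) =
      Real.exp (u / τ) / max (Real.exp (u / τ)) (Real.exp (v / τ)) := by
  rw [← exp_max_div hτ, ← Real.exp_sub, resistance, max_comm]
  congr 1
  ring

lemma logit_le {τ : ℝ} (hτ : 0 < τ) (u v : ℝ) :
    logit τ u v ≤ Real.exp (-resistance v u / τ) := by
  rw [exp_neg_resistance hτ, logit]
  gcongr
  exact max_le (le_add_of_nonneg_right (Real.exp_nonneg _))
    (le_add_of_nonneg_left (Real.exp_nonneg _))

lemma half_exp_le_logit {τ : ℝ} (hτ : 0 < τ) (u v : ℝ) :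
    1 / 2 * Real.exp (-resistance v u / τ) ≤ logit τ u v := by
  rw [exp_neg_resistance hτ, logit, div_mul_div_comm, one_mul]
  have h1 := le_max_left (Real.exp (u / τ)) (Real.exp (v / τ))
  have h2 := le_max_right (Real.exp (u / τ)) (Real.exp (v / τ))
  gcongr
  linarith

section Links

variable {ι : Type*} [DecidableEq ι] {A : ι → Type*} (m : ι → ι → (∀ i, A i) → ℝ)

lemma linkProb_self (τ : ℝ) (i : ι) (a : ∀ i, A i) : linkProb m τ i i a = 1 := if_pos rfl

lemma linkProb_nonneg (τ : ℝ) (i j : ι) (a : ∀ i, A i) : 0 ≤ linkProb m τ i j a := by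
  unfold linkProb
  split_ifs
  · exact zero_le_one
  · rw [eps_rpow]
    positivity

lemma linkProb_le_one (τ : ℝ) (i j : ι) (a : ∀ i, A i) : linkProb m τ i j a ≤ 1 := by
  unfold linkProb
  split_ifs
  · exact le_rfl
  · rw [eps_rpow]
    exact div_le_one_of_le₀ (le_add_of_nonneg_right (Real.exp_nonneg _)) (by positivity)

lemma one_sub_linkProb_le {τ : ℝ} (i j : ι) (a : ∀ i, A i) :
    1 - linkProb m τ i j a ≤ Real.exp (-m i j a / τ) := by
  unfold linkProb
  split_ifs
  · rw [sub_self]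
    positivity
  · rw [eps_rpow, sub_le_iff_le_add, ← sub_le_iff_le_add', le_div_iff₀ (by positivity)]
    nlinarith [sq_nonneg (Real.exp (-m i j a / τ))]

variable {m} in
lemma half_le_linkProb (hm : ∀ i j, i ≠ j → ∀ a, 0 < m i j a) {τ : ℝ} (hτ : 0 < τ) (i j : ι)
    (a : ∀ i, A i) : 1 / 2 ≤ linkProb m τ i j a := by
  unfold linkProb
  split_ifs with h
  · norm_num
  · rw [eps_rpow]
    have : Real.exp (-m i j a / τ) ≤ 1 := Real.exp_le_one_iff.2
      (div_nonpos_of_nonpos_of_nonneg (neg_nonpos.2 (hm i j h a).le) hτ.le)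
    gcongr
    linarith

variable [Fintype ι]

lemma commSetProb_nonneg (τ : ℝ) (i : ι) (C : Finset ι) (a : ∀ i, A i) :
    0 ≤ commSetProb m τ i C a :=
  mul_nonneg (prod_nonneg fun j _ => sub_nonneg.2 (linkProb_le_one m τ i j a))
    (prod_nonneg fun j _ => linkProb_nonneg m τ i j a)

lemma sum_commSetProb (τ : ℝ) (i : ι) (a : ∀ i, A i) :
    ∑ C : Finset ι, commSetProb m τ i C a = 1 := by
  have h := prod_add (fun j => linkProb m τ i j a) (fun j => 1 - linkProb m τ i j a) univ
  simp only [add_sub_cancel, prod_const_one, powerset_univ] at h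
  rw [h]
  refine sum_congr rfl fun C _ => ?_
  rw [commSetProb, mul_comm, compl_eq_univ_sdiff]

lemma commSetProb_eq_zero (τ : ℝ) {i : ι} {C : Finset ι} (hi : i ∉ C) (a : ∀ i, A i) :
    commSetProb m τ i C a = 0 := by
  rw [commSetProb, prod_eq_zero (mem_compl.2 hi) (by rw [linkProb_self, sub_self]), zero_mul]

/-- Each broken link `j ∉ C` costs a factor `ε ^ m i j a`. -/
lemma commSetProb_le (τ : ℝ) (i : ι) (C : Finset ι) (a : ∀ i, A i) :
    commSetProb m τ i C a ≤ Real.exp (-(∑ j ∈ Cᶜ, m i j a) / τ) := by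
  rw [← sum_neg_distrib, sum_div, Real.exp_sum]
  refine (mul_le_of_le_one_right ?_ (prod_le_one (fun j _ => linkProb_nonneg m τ i j a)
    fun j _ => linkProb_le_one m τ i j a)).trans ?_
  · exact prod_nonneg fun j _ => sub_nonneg.2 (linkProb_le_one m τ i j a)
  · exact prod_le_prod (fun j _ => sub_nonneg.2 (linkProb_le_one m τ i j a))
      fun j _ => one_sub_linkProb_le m i j a

variable {m} in
lemma half_pow_le_commSetProb_univ (hm : ∀ i j, i ≠ j → ∀ a, 0 < m i j a) {τ : ℝ} (hτ : 0 < τ)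
    (i : ι) (a : ∀ i, A i) : (1 / 2) ^ Fintype.card ι ≤ commSetProb m τ i univ a := by
  rw [commSetProb, compl_univ, prod_empty, one_mul, ← card_univ, ← prod_const]
  exact prod_le_prod (fun _ _ => by norm_num) fun j _ => half_le_linkProb hm hτ i j a

end Links

/-! ### Probability of switching to a trial action -/

lemma eq_update_symm {ι : Type*} [DecidableEq ι] {A : ι → Type*}
    {i : ι} {a b : ∀ i, A i} (h : b = Function.update a i (b i)) :
    a = Function.update b i (a i) := by
  funext j
  rcases eq_or_ne j i with rfl | hj
  · rw [Function.update_self]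
  · rw [Function.update_of_ne hj, h, Function.update_of_ne hj]

section Switch

variable {ι : Type*} [Fintype ι] [DecidableEq ι] {A : ι → Type*}

/-- The probability, at the profile `a`, that agent `i` switches to the trial action `x`, averaged
over the random set of agents that `i` communicates with. -/
noncomputable def switchProb (Uc : ι → Finset ι → (∀ i, A i) → ℝ)
    (m : ι → ι → (∀ i, A i) → ℝ) (τ : ℝ) (i : ι) (a : ∀ i, A i) (x : A i) : ℝ :=
  ∑ C : Finset ι, commSetProb m τ i C a * logit τ (Uc i C (Function.update a i x)) (Uc i C a)

variable {cons : ∀ i, A i → Finset (A i)} {U : ι → (∀ i, A i) → ℝ}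
  {Uc : ι → Finset ι → (∀ i, A i) → ℝ} {m : ι → ι → (∀ i, A i) → ℝ}

lemma switchProb_nonneg (τ : ℝ) (i : ι) (a : ∀ i, A i) (x : A i) :
    0 ≤ switchProb Uc m τ i a x :=
  sum_nonneg fun C _ => mul_nonneg (commSetProb_nonneg m τ i C a) (logit_nonneg _ _ _)

/-- By the condition on `m`, no communication set makes a move more likely, in exponential order,
than perfect communication does. -/
lemma switchProb_le (hsuff : SufficientLinks cons U Uc m) {τ : ℝ} (hτ : 0 < τ) (i : ι)
    (a : ∀ i, A i) {x : A i} (hx : x ∈ cons i (a i)) :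
    switchProb Uc m τ i a x ≤ 2 ^ Fintype.card ι *
      Real.exp (-resistance (U i a) (U i (Function.update a i x)) / τ) := by
  have hterm : ∀ C ∈ (univ : Finset (Finset ι)),
      commSetProb m τ i C a * logit τ (Uc i C (Function.update a i x)) (Uc i C a) ≤
        Real.exp (-resistance (U i a) (U i (Function.update a i x)) / τ) := fun C _ => by
    by_cases hi : i ∈ C
    · refine (mul_le_mul (commSetProb_le m τ i C a) (logit_le hτ _ _) (logit_nonneg _ _ _)
        (Real.exp_nonneg _)).trans ?_
      rw [← Real.exp_add, ← add_div]
      gcongr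
      linarith [hsuff i C hi a x hx]
    · rw [commSetProb_eq_zero m τ hi, zero_mul]
      exact Real.exp_nonneg _
  refine (sum_le_card_nsmul _ _ _ hterm).trans_eq ?_
  rw [card_univ, Fintype.card_finset, nsmul_eq_mul]
  push_cast
  rfl

/-- Perfect communication alone contributes the full exponential order. -/
lemma le_switchProb (hUc : ∀ i a, Uc i univ a = U i a) (hm : ∀ i j, i ≠ j → ∀ a, 0 < m i j a)
    {τ : ℝ} (hτ : 0 < τ) (i : ι) (a : ∀ i, A i) (x : A i) :
    (1 / 2) ^ Fintype.card ι *
      (1 / 2 * Real.exp (-resistance (U i a) (U i (Function.update a i x)) / τ)) ≤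
      switchProb Uc m τ i a x := by
  rw [← hUc, ← hUc]
  refine (mul_le_mul (half_pow_le_commSetProb_univ hm hτ i a) (half_exp_le_logit hτ _ _)
    (by positivity) (commSetProb_nonneg m τ i univ a)).trans ?_
  exact single_le_sum (f := fun C => commSetProb m τ i C a *
    logit τ (Uc i C (Function.update a i x)) (Uc i C a))
    (fun C _ => mul_nonneg (commSetProb_nonneg m τ i C a) (logit_nonneg _ _ _)) (mem_univ univ)

lemma switchProb_pos (hUc : ∀ i a, Uc i univ a = U i a) (hm : ∀ i j, i ≠ j → ∀ a, 0 < m i j a)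
    {τ : ℝ} (hτ : 0 < τ) (i : ι) (a : ∀ i, A i) (x : A i) : 0 < switchProb Uc m τ i a x :=
  lt_of_lt_of_le (by positivity) (le_switchProb hUc hm hτ i a x)

/-- A move and its reversal have resistances that differ by the difference of the potential, so the
switching probabilities are nearly in detailed balance with `exp (φ / τ)`. -/
lemma exp_mul_switchProb_le {φ : (∀ i, A i) → ℝ} (hφ : IsPotentialGame U φ)
    (hUc : ∀ i a, Uc i univ a = U i a) (hm : ∀ i j, i ≠ j → ∀ a, 0 < m i j a)
    (hsuff : SufficientLinks cons U Uc m) {τ : ℝ} (hτ : 0 < τ) (i : ι) {a b : ∀ i, A i}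
    (hb : b = Function.update a i (b i)) (hx : b i ∈ cons i (a i)) :
    Real.exp (φ a / τ) * switchProb Uc m τ i a (b i) ≤
      2 * 4 ^ Fintype.card ι * (Real.exp (φ b / τ) * switchProb Uc m τ i b (a i)) := by
  have ha : Function.update b i (a i) = a := (eq_update_symm hb).symm
  have hpot : U i b - U i a = φ b - φ a := by
    have := hφ i a (a i) (b i)
    rwa [← hb, Function.update_eq_self] at this
  have h1 := switchProb_le hsuff hτ i a hx
  have h2 := le_switchProb hUc hm hτ i b (a i)
  rw [ha] at h2
  rw [← hb] at h1
  have hE : Real.exp (φ a / τ) * Real.exp (-resistance (U i a) (U i b) / τ) =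
      Real.exp (φ b / τ) * Real.exp (-resistance (U i b) (U i a) / τ) := by
    rw [← Real.exp_add, ← Real.exp_add, ← add_div, ← add_div, resistance, resistance,
      max_comm (U i b)]
    congr 2
    linarith
  have h4 : (2 : ℝ) ^ Fintype.card ι =
      2 * 4 ^ Fintype.card ι * ((1 / 2) ^ Fintype.card ι * (1 / 2)) := by
    have : (4 : ℝ) ^ Fintype.card ι * (1 / 2) ^ Fintype.card ι = 2 ^ Fintype.card ι := by
      rw [← mul_pow]; norm_num
    rw [← this]; ring
  calc Real.exp (φ a / τ) * switchProb Uc m τ i a (b i)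
      ≤ Real.exp (φ a / τ) * (2 ^ Fintype.card ι *
          Real.exp (-resistance (U i a) (U i b) / τ)) := by gcongr
    _ = 2 ^ Fintype.card ι * (Real.exp (φ b / τ) *
          Real.exp (-resistance (U i b) (U i a) / τ)) := by rw [← hE]; ring
    _ = 2 * 4 ^ Fintype.card ι * (Real.exp (φ b / τ) * ((1 / 2) ^ Fintype.card ι *
          (1 / 2 * Real.exp (-resistance (U i b) (U i a) / τ)))) := by rw [h4]; ring
    _ ≤ _ := by gcongr

end Switch

/-! ### Reachability of profiles -/

/-- A set of profiles that is closed under feasible single-agent moves is empty or everything, as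
any profile can be rewritten into any other one agent at a time. -/
lemma mem_of_forall_update_mem {ι : Type*} [Fintype ι] [DecidableEq ι] {A : ι → Type*}
    {cons : ∀ i, A i → Finset (A i)} (hreach : Reachable cons) {S : Set (∀ i, A i)}
    (hS : ∀ a ∈ S, ∀ i, ∀ x ∈ cons i (a i), Function.update a i x ∈ S) {a : ∀ i, A i} (ha : a ∈ S)
    (b : ∀ i, A i) : b ∈ S := by
  have hstep : ∀ c ∈ S, ∀ i y, Function.update c i y ∈ S := fun c hc i y => by
    induction hreach i (c i) y with
    | refl => rwa [Function.update_eq_self]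
    | tail _ h ih =>
      have := hS _ ih i _ (by rwa [Function.update_self])
      rwa [Function.update_idem] at this
  have key : ∀ T : Finset ι, T.piecewise b a ∈ S := fun T => by
    induction T using Finset.induction_on with
    | empty => rwa [piecewise_empty]
    | insert i T _ ih =>
      rw [piecewise_insert]
      exact hstep _ ih _ _
  simpa only [piecewise_univ] using key univ

/-! ### The transition matrix -/

section Transition

variable {ι : Type*} [Fintype ι] [DecidableEq ι] {A : ι → Type*} [∀ i, DecidableEq (A i)]
  {cons : ∀ i, A i → Finset (A i)} {U : ι → (∀ i, A i) → ℝ}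
  {Uc : ι → Finset ι → (∀ i, A i) → ℝ} {m : ι → ι → (∀ i, A i) → ℝ}

lemma transition_nonneg (τ : ℝ) (a b : ∀ i, A i) : 0 ≤ transition cons Uc m τ a b := by
  refine sum_nonneg fun i _ => mul_nonneg (by positivity) <| sum_nonneg fun x _ =>
    mul_nonneg (by positivity) <| sum_nonneg fun C _ =>
      mul_nonneg (commSetProb_nonneg m τ i C a) (add_nonneg ?_ ?_)
  all_goals
    split_ifs
    · exact logit_nonneg _ _ _
    · exact le_rfl

lemma sum_transition [∀ i, Fintype (A i)] [Nonempty ι] (hne : ∀ i x, (cons i x).Nonempty) (τ : ℝ)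
    (a : ∀ i, A i) :
    ∑ b, transition cons Uc m τ a b = 1 := by
  have hn : (Fintype.card ι : ℝ) ≠ 0 := Nat.cast_ne_zero.2 Fintype.card_ne_zero
  have hc : ∀ i, ((cons i (a i)).card : ℝ) ≠ 0 := fun i =>
    Nat.cast_ne_zero.2 (card_pos.2 (hne i (a i))).ne'
  simp only [transition, Matrix.of_apply]
  rw [sum_comm]
  calc _ = ∑ _i : ι, 1 / (Fintype.card ι : ℝ) * 1 := sum_congr rfl fun i _ => ?_
    _ = 1 := by
      rw [sum_const, card_univ, nsmul_eq_mul, mul_one]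
      exact mul_one_div_cancel hn
  rw [← mul_sum, sum_comm]
  congr 1
  calc _ = ∑ _x ∈ cons i (a i), 1 / ((cons i (a i)).card : ℝ) * 1 := sum_congr rfl fun x _ => ?_
    _ = 1 := by
      rw [sum_const, nsmul_eq_mul, mul_one]
      exact mul_one_div_cancel (hc i)
  rw [← mul_sum, sum_comm]
  congr 1
  simp only [← mul_sum, sum_add_distrib, sum_ite_eq', mem_univ, if_true, logit_add_logit,
    mul_one, sum_commSetProb]

/-- Off the diagonal, only the trial action `b i` of an agent `i` can lead from `a` to `b`. -/
lemma transition_apply_of_ne (τ : ℝ) {a b : ∀ i, A i} (hab : a ≠ b) :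
    transition cons Uc m τ a b = ∑ i, 1 / (Fintype.card ι : ℝ) *
      if b = Function.update a i (b i) ∧ b i ∈ cons i (a i) then
        1 / ((cons i (a i)).card : ℝ) * switchProb Uc m τ i a (b i) else 0 := by
  simp only [transition, Matrix.of_apply, if_neg hab.symm, add_zero]
  refine sum_congr rfl fun i _ => congrArg _ ?_
  have hx : ∀ x, x ≠ b i → b ≠ Function.update a i x := fun x hx e => hx (by
    have := congrFun e i
    simpa using this.symm)
  by_cases hmem : b i ∈ cons i (a i)
  · rw [sum_eq_single_of_mem (b i) hmem fun x _ h => by simp [hx x h]]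
    by_cases he : b = Function.update a i (b i)
    · rw [if_pos ⟨he, hmem⟩]
      simp only [if_pos he, switchProb]
    · rw [if_neg fun h => he h.1]
      simp [if_neg he]
  · rw [if_neg fun h => hmem h.2]
    refine sum_eq_zero fun x hxm => ?_
    have : x ≠ b i := fun e => hmem (e ▸ hxm)
    simp [hx x this]

/-- The total number of actions bounds the ratio of the probabilities of a trial action and of its
reversal, which are drawn from sets of different sizes. -/
lemma nearlyReversible_transition [∀ i, Fintype (A i)] {φ : (∀ i, A i) → ℝ}
    (hφ : IsPotentialGame U φ)
    (hrev : Reversible cons)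
    (hUc : ∀ i a, Uc i univ a = U i a) (hm : ∀ i j, i ≠ j → ∀ a, 0 < m i j a)
    (hsuff : SufficientLinks cons U Uc m) {τ : ℝ} (hτ : 0 < τ) :
    NearlyReversible (transition cons Uc m τ) (fun a => Real.exp (φ a / τ))
      ((∑ i, Fintype.card (A i)) * (2 * 4 ^ Fintype.card ι)) := by
  intro a b hab
  rw [transition_apply_of_ne τ hab, transition_apply_of_ne τ hab.symm]
  simp only [mul_sum]
  refine sum_le_sum fun i _ => ?_
  by_cases h : b = Function.update a i (b i) ∧ b i ∈ cons i (a i)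
  · have h' : a = Function.update b i (a i) ∧ a i ∈ cons i (b i) :=
      ⟨eq_update_symm h.1, hrev i _ _ h.2⟩
    rw [if_pos h, if_pos h']
    have hs := exp_mul_switchProb_le hφ hUc hm hsuff hτ i h.1 h.2
    have hpos : 0 ≤ switchProb Uc m τ i a (b i) := switchProb_nonneg _ _ _ _
    have hc : (1 : ℝ) / (cons i (a i)).card ≤ 1 :=
      div_le_one_of_le₀ (by exact_mod_cast card_pos.2 ⟨_, h.2⟩) (Nat.cast_nonneg _)
    have hc' : 1 ≤ (∑ i, Fintype.card (A i) : ℝ) * (1 / (cons i (b i)).card) := by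
      rw [mul_one_div, one_le_div (by exact_mod_cast card_pos.2 ⟨_, h'.2⟩)]
      exact_mod_cast (card_le_univ (cons i (b i))).trans
        (single_le_sum (f := fun i => Fintype.card (A i)) (fun _ _ => Nat.zero_le _) (mem_univ i))
    calc Real.exp (φ a / τ) * (1 / (Fintype.card ι : ℝ) *
          (1 / ((cons i (a i)).card : ℝ) * switchProb Uc m τ i a (b i)))
        = 1 / (Fintype.card ι : ℝ) * ((1 / ((cons i (a i)).card : ℝ)) *
          (Real.exp (φ a / τ) * switchProb Uc m τ i a (b i))) := by ring
      _ ≤ 1 / (Fintype.card ι : ℝ) * (((∑ i, Fintype.card (A i) : ℝ) * (1 / (cons i (b i)).card)) *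
          (2 * 4 ^ Fintype.card ι * (Real.exp (φ b / τ) * switchProb Uc m τ i b (a i)))) := by
        refine mul_le_mul_of_nonneg_left (mul_le_mul (hc.trans hc') hs
          (mul_nonneg (Real.exp_nonneg _) hpos) (zero_le_one.trans hc'))
          (one_div_nonneg.2 (Nat.cast_nonneg _))
      _ = _ := by push_cast; ring
  · have h' : ¬(a = Function.update b i (a i) ∧ a i ∈ cons i (b i)) := fun h' =>
      h ⟨eq_update_symm h'.1, hrev i _ _ h'.2⟩
    rw [if_neg h, if_neg h']
    simp

lemma crossesCuts_transition [Nonempty ι] [∀ i, Fintype (A i)] (hreach : Reachable cons)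
    (hUc : ∀ i a, Uc i univ a = U i a) (hm : ∀ i j, i ≠ j → ∀ a, 0 < m i j a) {τ : ℝ}
    (hτ : 0 < τ) : CrossesCuts (transition cons Uc m τ) := by
  intro S hS hS'
  by_contra! hcon
  obtain ⟨a, ha⟩ := hS
  refine hS' (eq_univ_iff_forall.2 fun b =>
    mem_of_forall_update_mem (S := (S : Set (∀ i, A i))) hreach (fun c hc i x hx => ?_) ha b)
  by_contra hout
  have hne : c ≠ Function.update c i x := fun e => hout (e ▸ hc)
  refine absurd (hcon c hc _ hout) (not_le.2 ?_)
  rw [transition_apply_of_ne τ hne]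
  have hn : (0 : ℝ) < Fintype.card ι := Nat.cast_pos.2 Fintype.card_pos
  refine sum_pos' (fun j _ => mul_nonneg (by positivity) ?_) ⟨i, mem_univ i, ?_⟩
  · split_ifs
    · exact mul_nonneg (one_div_nonneg.2 (Nat.cast_nonneg _)) (switchProb_nonneg _ _ _ _)
    · exact le_rfl
  · have hc0 : (0 : ℝ) < (cons i (c i)).card := Nat.cast_pos.2 (card_pos.2 ⟨x, hx⟩)
    have := switchProb_pos hUc hm hτ i c x
    rw [Function.update_self, if_pos ⟨rfl, hx⟩]
    positivity

end Transition

/-! ### Concentration on the maximizers of the potential -/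

/-- A constant times a sum of exponentially small terms vanishes as `τ` decreases
to `0`. -/
lemma exists_forall_mul_sum_exp_le {X : Type*} (s : Finset X) {δ : X → ℝ} (hδ : ∀ a ∈ s, 0 < δ a)
    (c : ℝ) {η : ℝ} (hη : 0 < η) :
    ∃ τ₀ : ℝ, 0 < τ₀ ∧ ∀ τ, 0 < τ → τ ≤ τ₀ → c * ∑ a ∈ s, Real.exp (-δ a / τ) ≤ η := by
  have h : Filter.Tendsto (fun τ : ℝ => c * ∑ a ∈ s, Real.exp (-δ a / τ))
      (nhdsWithin 0 (Set.Ioi 0)) (nhds (c * ∑ a ∈ s, 0)) := by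
    refine (tendsto_finsetSum s fun a ha => Real.tendsto_exp_atBot.comp ?_).const_mul c
    exact tendsto_inv_nhdsGT_zero.const_mul_atTop_of_neg (neg_neg_of_pos (hδ a ha))
  rw [sum_const_zero, mul_zero] at h
  obtain ⟨τ₀, h0, hsub⟩ := mem_nhdsGT_iff_exists_Ioc_subset.1 (h.eventually_le_const hη)
  exact ⟨τ₀, h0, fun τ h1 h2 => hsub ⟨h1, h2⟩⟩

end BLLL

theorem theorem2
    {ι : Type*} [Fintype ι] [DecidableEq ι] [Nonempty ι]
    {A : ι → Type*} [∀ i, Fintype (A i)] [∀ i, DecidableEq (A i)] [∀ i, Nonempty (A i)]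
    (U : ι → (∀ i, A i) → ℝ) (φ : (∀ i, A i) → ℝ)
    (hφ : BLLL.IsPotentialGame U φ)
    (cons : ∀ i, A i → Finset (A i))
    (hne : ∀ i x, (cons i x).Nonempty)
    (hreach : BLLL.Reachable cons) (hrev : BLLL.Reversible cons)
    (Uc : ι → Finset ι → (∀ i, A i) → ℝ)
    (hUc : ∀ i a, Uc i Finset.univ a = U i a)
    (m : ι → ι → (∀ i, A i) → ℝ)
    (hm : ∀ i j, i ≠ j → ∀ a, 0 < m i j a)
    (hsuff : BLLL.SufficientLinks cons U Uc m)
    (ptar : ℝ) (hptar : ptar < 1) :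
    ∃ τth : ℝ, 0 < τth ∧ ∀ τ : ℝ, 0 < τ → τ ≤ τth →
      ∃ μ : (∀ i, A i) → ℝ,
        BLLL.IsStationary (BLLL.transition cons Uc m τ) μ ∧
        (∀ ν : (∀ i, A i) → ℝ, BLLL.IsStationary (BLLL.transition cons Uc m τ) ν → ν = μ) ∧
        ptar ≤ ∑ a ∈ BLLL.potentialMaximizers φ, μ a := by
  obtain ⟨b, hb⟩ := Finite.exists_max φ
  set K : ℝ := (∑ i, Fintype.card (A i) : ℕ) * (2 * 4 ^ Fintype.card ι) with hKdef
  have hK : 1 ≤ K := by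
    have h1 : (1 : ℝ) ≤ (∑ i, Fintype.card (A i) : ℕ) :=
      Nat.one_le_cast.2 (sum_pos (fun i _ => Fintype.card_pos) univ_nonempty)
    have h2 : (1 : ℝ) ≤ 4 ^ Fintype.card ι := one_le_pow₀ (by norm_num)
    nlinarith
  have hδ : ∀ a ∈ (BLLL.potentialMaximizers φ)ᶜ, 0 < φ b - φ a := fun a ha => by
    simp only [BLLL.potentialMaximizers, mem_compl, mem_filter, mem_univ, true_and, not_forall,
      not_le] at ha
    obtain ⟨c, hc⟩ := ha
    linarith [hb c]
  obtain ⟨τ₀, hτ₀, hsmall⟩ := BLLL.exists_forall_mul_sum_exp_le _ hδ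
    (K ^ Fintype.card (∀ i, A i)) (sub_pos.2 hptar)
  refine ⟨τ₀, hτ₀, fun τ hτ hle => ?_⟩
  have hP := BLLL.transition_nonneg (cons := cons) (Uc := Uc) (m := m) τ
  have hrow := BLLL.sum_transition (Uc := Uc) (m := m) hne τ
  have hcut := BLLL.crossesCuts_transition hreach hUc hm hτ
  have hnear := BLLL.nearlyReversible_transition hφ hrev hUc hm hsuff hτ
  obtain ⟨μ, hμ⟩ := BLLL.exists_isStationary hP hrow
  refine ⟨μ, hμ, fun ν hν => BLLL.IsStationary.unique hP hrow hcut hK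
    (fun a => Real.exp_pos _) hnear hμ hν, ?_⟩
  have hμb : μ b ≤ 1 := hμ.1.2 ▸ single_le_sum (fun a _ => hμ.1.1 a) (mem_univ b)
  have hbound : ∀ a, μ a ≤ K ^ Fintype.card (∀ i, A i) * Real.exp (-(φ b - φ a) / τ) := fun a => by
    have h := BLLL.density_le hP hrow hcut hK (fun a => Real.exp_pos _) hnear hμ.1.1 hμ.2 a b
    have h' := h.trans (mul_le_of_le_one_right (by positivity) hμb)
    rw [div_mul_eq_mul_div, mul_div_assoc, ← Real.exp_sub, ← le_div_iff₀ (Real.exp_pos _)] at h'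
    refine h'.trans_eq ?_
    rw [div_eq_mul_inv, ← Real.exp_neg]
    congr 2
    ring
  have hcompl : ∑ a ∈ (BLLL.potentialMaximizers φ)ᶜ, μ a ≤ 1 - ptar :=
    (sum_le_sum fun a _ => hbound a).trans (by
      rw [← mul_sum]
      exact hsmall τ hτ hle)
  have htot := sum_add_sum_compl (BLLL.potentialMaximizers φ) μ
  rw [hμ.1.2] at htot
  linarith
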